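/- Let $\lambda_1,\lambda_2,\mu_1,\mu_2>0$, $\rho_1=\lambda_1/\mu_1$, and $\alpha^*=\rho_1/(1-\rho_1)$, with $\alpha^*=+\infty$ if $\rho_1\ge 1$. For $x=(x_1,x_2)\in\mathbb{N}^2$ and $i=1,2$ set $$W_i(x)=\frac{\log(1+x_i)}{\log(1+x_1)+\log(1+x_2)},\qquad \tfrac00:=0 .$$ Let $\mathcal{A}_1,\mathcal{A}_2,\mathcal{D}_1,\mathcal{D}_2$ be independent homogeneous Poisson point processes with rate $1$ on $\mathbb{R}_+^2$, whose points are written (height, time). For each $N\in\mathbb{N}$, let $(L_1^N(t),L_2^N(t))_{t\ge0}$ be an $\mathbb{N}^2$-valued process with càdlàg paths, started at $(L_1^N(0),L_2^N(0))=(0,N)$, which almost surely satisfies, for all $t\ge0$ and $i=1,2$, $$L_i^N(t)=L_i^N(0)+\mathcal{A}_i\big([0,\lambda_i]\times(0,t]\big)-\int_{(0,t]}\mathcal{D}_i\big([0,\mu_iW_i(L_1^N(u-),L_2^N(u-))]\times \mathrm{d}u\big)$$ (for different $N$, the processes may be defined on different probability spaces). Then, as $N\to+\infty$, the convergence in distribution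 of processes $$\left(\frac{L_1^N(N^t)}{N^t},\ 0<t<\alpha^*\wedge1\right)\longrightarrow\left(\lambda_1-\mu_1\frac{t}{t+1},\ 0<t<\alpha^*\wedge1\right)$$ holds for the topology of uniform convergence on compact subsets of $(0,\alpha^*\wedge1)$. That is, $\mathbb{E}^*\big[F\big((L_1^N(N^t)/N^t)_t\big)\big]\to F\big((\lambda_1-\mu_1 t/(t+1))_t\big)$ for every bounded real function $F$ that is continuous for this topology on the space of real functions on $(0,\alpha^*\wedge1)$, where $\mathbb{E}^*$ is the outer expectation. -/

import Mathlib

open MeasureTheory ProbabilityTheory Filter Topology Set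
open scoped ENNReal NNReal UniformConvergence BoundedContinuousFunction

noncomputable section

namespace LogQueue

/-! ### Poisson point processes -/

/-- `Γ` is a Poisson point process on `E` with intensity measure `ν`, defined on `(Ω, P)`:
a random measure with values in `{0, 1, 2, …, ∞}` whose value on a measurable set `B` of finite
intensity is Poisson distributed with mean `ν B`, and whose values on pairwise disjoint
measurable sets are independent. -/
structure IsPoissonPointProcess {Ω E : Type*} [MeasurableSpace Ω] [MeasurableSpace E]
    (P : Measure Ω) (ν : Measure E) (Γ : Ω → Measure E) : Prop where
  measurable : Measurable Γ
  counting : ∀ᵐ ω ∂P, ∀ B : Set E, MeasurableSet B → ∃ n : ℕ∞, Γ ω B = (n : ℝ≥0∞)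
  law : ∀ B : Set E, MeasurableSet B → ν B ≠ ∞ →
    HasLaw (fun ω => Γ ω B)
      ((poissonMeasure (ν B).toNNReal).map (fun k : ℕ => (k : ℝ≥0∞))) P
  indep : ∀ (n : ℕ) (B : Fin n → Set E), (∀ i, MeasurableSet (B i)) →
    Pairwise (fun i j => Disjoint (B i) (B j)) → iIndepFun (fun i ω => Γ ω (B i)) P

/-- Lebesgue measure on the quadrant `[0,∞) × [0,∞)`, seen as a measure on the plane. -/
def quadrantLebesgue : Measure (ℝ × ℝ) :=
  (volume : Measure (ℝ × ℝ)).restrict (Ici 0 ×ˢ Ici 0)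

/-- For a configuration `γ` of points `(y, u)` (height `y`, time `u`), the number of points with
time in `(0, t]` which lie under the graph of `h`, i.e. `∫_{(0,t]} γ([0, h(u)] × du)`.
When `γ` is a Poisson point process of rate `1` on the quadrant this is the number of points in
`(0, t]` of the process with rate function `h`. -/
def pointsBelow (γ : Measure (ℝ × ℝ)) (h : ℝ → ℝ) (t : ℝ) : ℝ :=
  γ.real {p : ℝ × ℝ | p.2 ∈ Ioc 0 t ∧ p.1 ∈ Icc 0 (h p.2)}

/-! ### The queueing system -/

/-- The fraction of the capacity received by queue `i` in state `x`; `0 / 0 = 0`. -/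
def capacity (i : Fin 2) (x : Fin 2 → ℕ) : ℝ :=
  Real.log (1 + x i) / (Real.log (1 + x 0) + Real.log (1 + x 1))

/-- The four driving noises: `A i` for the arrivals and `D i` for the departures of queue `i` are
independent Poisson point processes on the quadrant with rate `1`. -/
structure IsDrivingNoise {Ω : Type*} [MeasurableSpace Ω] (P : Measure Ω)
    (A D : Fin 2 → Ω → Measure (ℝ × ℝ)) : Prop where
  arrivals : ∀ i, IsPoissonPointProcess P quadrantLebesgue (A i)
  departures : ∀ i, IsPoissonPointProcess P quadrantLebesgue (D i)
  indep : iIndepFun (fun j : Fin 2 ⊕ Fin 2 => Sum.elim A D j) P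

/-- `L = (L 0, L 1)`, an `ℕ²`-valued càdlàg process with time set `[0,∞)`, is a solution of
`dL_i(t) = N_{lam i}(dt) - N_{mu i * W_i(L(t-))}(dt)`, `i = 0, 1`, with initial state `x`.
(The values of `L i t` for `t < 0` play no role.) -/
structure IsSolution {Ω : Type*} [MeasurableSpace Ω] (P : Measure Ω) (lam mu : Fin 2 → ℝ)
    (A D : Fin 2 → Ω → Measure (ℝ × ℝ)) (x : Fin 2 → ℕ) (L : Fin 2 → ℝ → Ω → ℕ) : Prop where
  measurable : ∀ i, ∀ t, 0 ≤ t → Measurable (L i t)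
  initial : ∀ i, ∀ᵐ ω ∂P, L i 0 ω = x i
  right_continuous : ∀ i, ∀ᵐ ω ∂P, ∀ t, 0 ≤ t →
    ContinuousWithinAt (fun s => L i s ω) (Ici t) t
  left_limits : ∀ i, ∀ᵐ ω ∂P, ∀ t, 0 < t →
    ∃ k : ℕ, Tendsto (fun s => L i s ω) (𝓝[<] t) (𝓝 k)
  equation : ∀ i, ∀ᵐ ω ∂P, ∀ t, 0 ≤ t →
    (L i t ω : ℝ) = (L i 0 ω : ℝ) + pointsBelow (A i ω) (fun _ => lam i) t
      - pointsBelow (D i ω)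
          (fun u => mu i * capacity i (fun j => Function.leftLim (fun s => L j s ω) u)) t

/-- `α* = ρ / (1 - ρ)`, which is `∞` when `ρ ≥ 1`. -/
def alphaStar (ρ : ℝ) : EReal :=
  if ρ < 1 then ((ρ / (1 - ρ) : ℝ) : EReal) else ⊤

/-- The open interval `(0, α* ∧ 1)`. -/
def timeInterval (ρ : ℝ) : Set ℝ :=
  {t : ℝ | 0 < t ∧ (t : EReal) < min (alphaStar ρ) 1}

/-! ### Convergence in distribution -/

/-- The outer expectation of a bounded function `f`, not necessarily measurable. -/
def outerExpectation {Ω : Type*} [MeasurableSpace Ω] (P : Measure Ω) (f : Ω → ℝ) : ℝ :=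
  sInf {c : ℝ | ∃ g : Ω → ℝ, Measurable g ∧ Integrable g P ∧ (∀ ω, f ω ≤ g ω) ∧ c = ∫ ω, g ω ∂P}

/-- Convergence in distribution of maps `X n : Ω n → E` to a Borel random element `Z` of the
topological space `E`, in the sense of Hoffmann-Jørgensen: `E*[F(X n)] → E[F(Z)]` for every
bounded continuous `F : E → ℝ`. Outer expectations are used because a process with jumps need not
be Borel measurable as a random function for the topology of uniform convergence. -/
structure ConvergesInDistribution {Ω : ℕ → Type*} [∀ n, MeasurableSpace (Ω n)]
    {Ω' : Type*} [MeasurableSpace Ω'] {E : Type*} [TopologicalSpace E]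
    (P : ∀ n, Measure (Ω n)) (X : ∀ n, Ω n → E) (Q : Measure Ω') (Z : Ω' → E) : Prop where
  measurable_limit : @Measurable Ω' E _ (borel E) Z
  tendsto : ∀ F : E →ᵇ ℝ,
    Tendsto (fun n => outerExpectation (P n) (fun ω => F (X n ω))) atTop (𝓝 (∫ ω, F (Z ω) ∂Q))

/-- Real functions on `S`, with the topology of uniform convergence on the compact subsets
of `S`. -/
abbrev PathSpace (S : Set ℝ) : Type := S →ᵤ[{K : Set S | IsCompact K}] ℝ

/-- The function `x` as an element of the path space. -/
def toPath (S : Set ℝ) (x : ℝ → ℝ) : PathSpace S :=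
  UniformOnFun.ofFun {K : Set S | IsCompact K} (fun t : S => x t)

end LogQueue

end

noncomputable section

namespace LogQueue

/-! ### A law of large numbers for Poisson point processes -/

/-! The capacity depends on the queues only through logarithms, so constant factors are negligible
at scale `log N`. Let `s = N ^ t` with `t < 1`. Up to time `s`, queue `1` moves by `O(s) = o(N)`, so
its logarithm stays `log N + O(1)`. Queue `0` is at most `O(s)`, with logarithm at most `t log N +
O(1)`. Its share is thus at most `t / (t + 1) + o(1)`, which bounds its departures and gives the
lower half of the limit (`IsPath.le_zero_rpow`).

Below `α*` the limiting slope is positive, so this lower bound makes queue `0` at least `c u` at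
every time `u` between `N ^ (a / 2)` and `N ^ b`. On `[ε s, s]` its logarithm is then also at least
`t log N - O(1)`, its share is at least `t / (t + 1) - o(1)`, and the matching upper bound follows
(`IsPath.zero_rpow_le`).

These arguments are pathwise: the random departure rate is compared with constant heights, so only
counts in rectangles matter. Those heights vary with `t`, which is why the law of large numbers must
be uniform in the height; its threshold `T` does not depend on the probability space. The limit is
deterministic, so convergence in probability, uniform on compact sets, suffices. -/

/-- The mean of a Poisson distribution, as a series. -/
lemma hasSum_poisson_mul_self (r : ℝ≥0) :
    HasSum (fun n : ℕ => Real.exp (-r) * r ^ n / n.factorial * n) r := by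
  -- The term `n = 0` vanishes, and `n / n! = 1 / (n - 1)!` lowers the moment by one after the
  -- shift.
  rw [← hasSum_nat_add_iff' 1]
  have h := (hasSum_one_poissonMeasure r).mul_left (r : ℝ)
  convert! h using 1
  · funext n
    rw [Nat.factorial_succ]
    push_cast
    have : (n.factorial : ℝ) ≠ 0 := by positivity
    field_simp
    ring
  · simp

/-- The second factorial moment of a Poisson distribution, as a series. -/
lemma hasSum_poisson_mul_sub_one (r : ℝ≥0) :
    HasSum (fun n : ℕ => Real.exp (-r) * r ^ n / n.factorial * (n * (n - 1))) ((r : ℝ) ^ 2) := by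
  rw [← hasSum_nat_add_iff' 1]
  have h := (hasSum_poisson_mul_self r).mul_left (r : ℝ)
  convert! h using 1
  · funext n
    rw [Nat.factorial_succ]
    push_cast
    have : (n.factorial : ℝ) ≠ 0 := by positivity
    field_simp
    ring
  · simp [sq]

/-- The variance of a Poisson distribution, as a series. -/
lemma hasSum_poisson_mul_sub_sq (r : ℝ≥0) :
    HasSum (fun n : ℕ => Real.exp (-r) * r ^ n / n.factorial * ((n : ℝ) - r) ^ 2) r := by
  -- Expansion `(n - r)² = n (n - 1) + (1 - 2 r) n + r²`.
  have h := ((hasSum_poisson_mul_sub_one r).add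
    ((hasSum_poisson_mul_self r).mul_left (1 - 2 * (r : ℝ)))).add
      ((hasSum_one_poissonMeasure r).mul_left ((r : ℝ) ^ 2))
  convert! h using 1
  · funext n
    ring
  · ring

/-- Chebyshev's inequality for the Poisson distribution. -/
lemma poissonMeasure_abs_sub_le (r : ℝ≥0) {x : ℝ} (hx : 0 < x) :
    poissonMeasure r {n : ℕ | x ≤ |(n : ℝ) - r|} ≤ ENNReal.ofReal (r / x ^ 2) := by
  have hsum := hasSum_poisson_mul_sub_sq r
  have hint : Integrable (fun n : ℕ => ((n : ℝ) - r) ^ 2) (poissonMeasure r) := by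
    rw [integrable_poissonMeasure_iff]
    refine hsum.summable.congr fun n => ?_
    rw [Real.norm_of_nonneg (sq_nonneg _)]
  have hval : ∫ n : ℕ, ((n : ℝ) - r) ^ 2 ∂(poissonMeasure r) = r := by
    rw [integral_poissonMeasure' hint]
    simpa using hsum.tsum_eq
  have hmarkov := mul_meas_ge_le_integral_of_nonneg
    (Eventually.of_forall fun n : ℕ => sq_nonneg ((n : ℝ) - r)) hint (x ^ 2)
  have hset : {n : ℕ | x ^ 2 ≤ ((n : ℝ) - r) ^ 2} = {n : ℕ | x ≤ |(n : ℝ) - r|} := by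
    ext n
    simp only [mem_ofPred_eq]
    rw [← sq_abs ((n : ℝ) - r)]
    exact pow_le_pow_iff_left₀ hx.le (abs_nonneg _) two_ne_zero
  rw [hval, hset] at hmarkov
  rw [← ofReal_measureReal (measure_ne_top _ _)]
  refine ENNReal.ofReal_le_ofReal ?_
  rw [le_div_iff₀ (by positivity), mul_comm]
  exact hmarkov

/-- The set of points with height at most `h` and time in `(0, t]`. -/
def box (h t : ℝ) : Set (ℝ × ℝ) := Icc 0 h ×ˢ Ioc 0 t

lemma measurableSet_box (h t : ℝ) : MeasurableSet (box h t) :=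
  measurableSet_Icc.prod measurableSet_Ioc

lemma box_subset_box {h h' t t' : ℝ} (hh : h ≤ h') (ht : t ≤ t') : box h t ⊆ box h' t' :=
  prod_mono (Icc_subset_Icc_right hh) (Ioc_subset_Ioc_right ht)

lemma quadrantLebesgue_box {h t : ℝ} (hh : 0 ≤ h) :
    quadrantLebesgue (box h t) = ENNReal.ofReal (h * t) := by
  have hsub : box h t ⊆ Ici 0 ×ˢ Ici 0 :=
    prod_mono Icc_subset_Ici_self (Ioc_subset_Icc_self.trans Icc_subset_Ici_self)
  rw [quadrantLebesgue, Measure.restrict_apply (measurableSet_box h t),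
    inter_eq_self_of_subset_left hsub, box, Measure.volume_eq_prod, Measure.prod_prod,
    Real.volume_Icc, Real.volume_Ioc, ← ENNReal.ofReal_mul (by simpa using hh)]
  simp

/-- `γ` has finitely many points in each box, and the number of points in `[0, h] × (0, t]`
is `h t` up to an error `ε t`, for all `h ≤ M` and `t ≥ T`. -/
structure HasUniformRate (γ : Measure (ℝ × ℝ)) (M ε T : ℝ) : Prop where
  finite : ∀ h t, γ (box h t) ≠ ∞
  rate : ∀ h, 0 ≤ h → h ≤ M → ∀ t, T ≤ t → |γ.real (box h t) - h * t| ≤ ε * t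

section Poisson

universe u

variable {Ω : Type u} [MeasurableSpace Ω] {P : Measure Ω} {Γ : Ω → Measure (ℝ × ℝ)}

/-- A Poisson law gives no mass to `∞`, and countably many boxes `box n n` absorb all the others. -/
lemma IsPoissonPointProcess.ae_box_ne_top (hΓ : IsPoissonPointProcess P quadrantLebesgue Γ) :
    ∀ᵐ ω ∂P, ∀ h t, Γ ω (box h t) ≠ ∞ := by
  have key : ∀ n : ℕ, ∀ᵐ ω ∂P, Γ ω (box n n) ≠ ∞ := by
    intro n
    have hlaw := hΓ.law (box n n) (measurableSet_box _ _) (by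
      rw [quadrantLebesgue_box n.cast_nonneg]; exact ENNReal.ofReal_ne_top)
    rw [ae_iff]
    have := hlaw.measure_eq (p := fun x => ¬ x ≠ ∞) (by simp)
    rw [this, Measure.map_apply (by fun_prop) (by simp)]
    convert measure_empty (μ := poissonMeasure (quadrantLebesgue (box n n)).toNNReal)
    ext k
    simp
  filter_upwards [ae_all_iff.2 key] with ω hω h t
  obtain ⟨n, hn⟩ := exists_nat_ge (max h t)
  exact measure_ne_top_of_subset
    (box_subset_box ((le_max_left _ _).trans hn) ((le_max_right _ _).trans hn)) (hω n)

lemma IsPoissonPointProcess.measure_abs_sub_le (hΓ : IsPoissonPointProcess P quadrantLebesgue Γ)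
    {h t x : ℝ} (hh : 0 ≤ h) (ht : 0 ≤ t) (hx : 0 < x) :
    P {ω | x ≤ |(Γ ω).real (box h t) - h * t|} ≤ ENNReal.ofReal (h * t / x ^ 2) := by
  have hν := quadrantLebesgue_box (t := t) hh
  have hlaw := hΓ.law (box h t) (measurableSet_box _ _) (by rw [hν]; exact ENNReal.ofReal_ne_top)
  have hmeas : MeasurableSet {y : ℝ≥0∞ | x ≤ |y.toReal - h * t|} :=
    measurableSet_le measurable_const (by fun_prop)
  have hr : (((quadrantLebesgue (box h t)).toNNReal : ℝ≥0) : ℝ) = h * t := by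
    rw [hν, ENNReal.coe_toNNReal_eq_toReal, ENNReal.toReal_ofReal (by positivity)]
  have := hlaw.measure_eq (p := fun y => x ≤ |y.toReal - h * t|) hmeas
  simp only [measureReal_def]
  rw [this, Measure.map_apply (by fun_prop) hmeas]
  have hcheb := poissonMeasure_abs_sub_le (quadrantLebesgue (box h t)).toNNReal hx
  rw [hr] at hcheb
  simpa using hcheb

end Poisson

/-- Control of the counts on a grid of heights and times gives control everywhere. -/
lemma HasUniformRate.of_grid {γ : Measure (ℝ × ℝ)} {M ε : ℝ} (hε : 0 < ε) (hM : 0 < M)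
    {K m : ℕ} (hK : M < K * ε) (hm0 : 0 < m) (hm : 3 * (M + 2 * ε) ≤ ε * m)
    (hfin : ∀ h t, γ (box h t) ≠ ∞)
    (hgrid : ∀ n, m ≤ n → ∀ k, k ≤ K →
      |γ.real (box (k * ε) ((n : ℝ) ^ 2)) - k * ε * (n : ℝ) ^ 2| ≤ ε * (n : ℝ) ^ 2) :
    HasUniformRate γ M (3 * ε) ((m : ℝ) ^ 2) := by
  refine ⟨hfin, fun h h0 hhM t ht => ?_⟩
  have ht0 : 0 ≤ t := le_trans (by positivity) ht
  -- The time grid consists of squares: sparse enough for the Chebyshev bounds to be summable, dense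
  -- enough for consecutive points to have ratio tending to `1`.
  set n := ⌊√t⌋₊ with hn
  have hmn : m ≤ n := Nat.le_floor (Real.le_sqrt_of_sq_le ht)
  have hn1 : (n : ℝ) ≤ √t := Nat.floor_le (Real.sqrt_nonneg t)
  have hn2 : √t < n + 1 := Nat.lt_floor_add_one _
  have hst : √t ^ 2 = t := Real.sq_sqrt ht0
  have hnt : (n : ℝ) ^ 2 ≤ t := by
    rw [← hst]; exact pow_le_pow_left₀ (by positivity) hn1 2
  have htn : t ≤ ((n + 1 : ℕ) : ℝ) ^ 2 := by
    rw [← hst]; push_cast; exact pow_le_pow_left₀ (by positivity) hn2.le 2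
  set k := ⌊h / ε⌋₊ with hk
  have hk1 : (k : ℝ) * ε ≤ h := by
    rw [← le_div_iff₀ hε]; exact Nat.floor_le (by positivity)
  have hk2 : h ≤ ((k + 1 : ℕ) : ℝ) * ε := by
    rw [← div_le_iff₀ hε]; push_cast; exact (Nat.lt_floor_add_one _).le
  have hkK : k + 1 ≤ K := by
    have : (k : ℝ) * ε < K * ε := lt_of_le_of_lt (hk1.trans hhM) hK
    exact_mod_cast (mul_lt_mul_iff_of_pos_right hε).1 this
  have hup := abs_le.1 (hgrid (n + 1) (by omega) (k + 1) hkK)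
  have hlo := abs_le.1 (hgrid n hmn k (by omega))
  have hmono1 : γ.real (box h t) ≤ γ.real (box ((k + 1 : ℕ) * ε) (((n + 1 : ℕ) : ℝ) ^ 2)) :=
    measureReal_mono (box_subset_box hk2 htn) (hfin _ _)
  have hmono2 : γ.real (box (k * ε) ((n : ℝ) ^ 2)) ≤ γ.real (box h t) :=
    measureReal_mono (box_subset_box hk1 hnt) (hfin _ _)
  have hn0 : (1 : ℝ) ≤ n := by exact_mod_cast hm0.trans_le hmn
  have hmn' : (m : ℝ) ≤ n := by exact_mod_cast hmn
  -- the gap between consecutive squares is negligible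
  have hgap : (M + 2 * ε) * (2 * n + 1) ≤ ε * n ^ 2 := by
    have h1 : (M + 2 * ε) * (2 * n + 1) ≤ (M + 2 * ε) * (3 * n) := by
      gcongr; linarith
    have h2 : 3 * (M + 2 * ε) * n ≤ ε * m * n := by gcongr
    have h3 : ε * m * n ≤ ε * n * n := by gcongr
    nlinarith
  push_cast at hup hmono1 hk2 htn
  have hn2t : ε * (n : ℝ) ^ 2 ≤ ε * t := by gcongr
  have hεt : 0 ≤ ε * t := by positivity
  rw [abs_le]
  constructor
  · rcases le_total (h - 2 * ε) 0 with h2 | h2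
    · have := measureReal_nonneg (μ := γ) (s := box h t)
      have := mul_nonpos_of_nonpos_of_nonneg h2 ht0
      linarith
    · have h1 : (h - ε) * (n : ℝ) ^ 2 ≤ k * ε * (n : ℝ) ^ 2 := by gcongr; linarith
      have h3 : (h - 2 * ε) * (t - n ^ 2) ≤ (M + 2 * ε) * (2 * n + 1) :=
        mul_le_mul (by linarith) (by linarith) (by linarith) (by positivity)
      linarith
  · have h1 : ((k : ℝ) + 1) * ε * (n + 1) ^ 2 ≤ (h + ε) * (n + 1) ^ 2 := by gcongr; linarith
    have h2 : (h + 2 * ε) * (n : ℝ) ^ 2 ≤ (h + 2 * ε) * t := by gcongr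
    have h3 : (h + 2 * ε) * (2 * (n : ℝ) + 1) ≤ (M + 2 * ε) * (2 * n + 1) := by gcongr
    linarith

/-- A law of large numbers for Poisson point processes, uniform in the height and in the
probability space. -/
theorem exists_forall_measure_not_hasUniformRate_le {M ε : ℝ} (hM : 0 < M) (hε : 0 < ε)
    {δ : ℝ} (hδ : 0 < δ) :
    ∃ T : ℝ, 0 < T ∧ ∀ {Ω : Type*} [MeasurableSpace Ω] (P : Measure Ω)
      (Γ : Ω → Measure (ℝ × ℝ)), IsPoissonPointProcess P quadrantLebesgue Γ →
      P {ω | ¬ HasUniformRate (Γ ω) M ε T} ≤ ENNReal.ofReal δ := by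
  -- Passing from the grid to all heights and times triples the error in `HasUniformRate.of_grid`.
  set e := ε / 3 with he
  have he0 : 0 < e := by positivity
  obtain ⟨K, hK⟩ := exists_nat_gt (M / e)
  rw [div_lt_iff₀ he0] at hK
  -- Union bound over `K + 1` heights, each with Chebyshev bound at most `K e n² / (e n²)²`.
  set c : ℝ := (K + 1) * (K * e / e ^ 2) with hc
  have hsum : Summable fun n : ℕ => c * (1 / (n : ℝ) ^ 2) :=
    (Real.summable_one_div_nat_pow.2 one_lt_two).mul_left c
  have htail := tendsto_sum_nat_add fun n : ℕ => c * (1 / (n : ℝ) ^ 2)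
  obtain ⟨m₀, hm₀⟩ := exists_nat_ge (3 * (M + 2 * e) / e)
  obtain ⟨m, hm1, hm2, hm3⟩ := ((htail.eventually (gt_mem_nhds hδ)).and
    ((eventually_ge_atTop m₀).and (eventually_gt_atTop 0))).exists
  refine ⟨(m : ℝ) ^ 2, by positivity, fun {Ω} _ P Γ hΓ => ?_⟩
  set B : ℕ → ℕ → Set Ω := fun n k => {ω | e * (n : ℝ) ^ 2 ≤
    |(Γ ω).real (box (k * e) ((n : ℝ) ^ 2)) - k * e * (n : ℝ) ^ 2|} with hB
  have hsub : {ω | ¬ HasUniformRate (Γ ω) M ε ((m : ℝ) ^ 2)} ⊆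
      {ω | ¬ ∀ h t, Γ ω (box h t) ≠ ∞} ∪ ⋃ n : ℕ, ⋃ k ∈ Finset.range (K + 1), B (n + m) k := by
    intro ω hω
    by_contra hcon
    simp only [mem_union, not_or, mem_ofPred_eq, not_not, mem_iUnion, not_exists] at hcon
    refine hω ?_
    have : ε = 3 * e := by rw [he]; ring
    rw [this]
    refine HasUniformRate.of_grid he0 hM hK hm3 ?_ hcon.1 fun n hn k hk => ?_
    · have : (m₀ : ℝ) ≤ m := by exact_mod_cast hm2
      have := hm₀.trans this
      rwa [div_le_iff₀ he0, mul_comm (m : ℝ)] at this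
    · have := hcon.2 (n - m) k (Finset.mem_range.2 (by omega))
      rw [Nat.sub_add_cancel hn] at this
      simp only [hB, mem_ofPred_eq, not_le] at this
      exact this.le
  have hBle : ∀ n : ℕ, 0 < n → P (⋃ k ∈ Finset.range (K + 1), B n k) ≤
      ENNReal.ofReal (c * (1 / (n : ℝ) ^ 2)) := by
    intro n hn
    have hn' : (0 : ℝ) < n := by exact_mod_cast hn
    calc P (⋃ k ∈ Finset.range (K + 1), B n k)
        ≤ ∑ k ∈ Finset.range (K + 1), P (B n k) := measure_biUnion_finset_le _ _
      _ ≤ ∑ _k ∈ Finset.range (K + 1), ENNReal.ofReal (K * e / e ^ 2 * (1 / (n : ℝ) ^ 2)) := by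
          refine Finset.sum_le_sum fun k hk => ?_
          refine (hΓ.measure_abs_sub_le (by positivity) (by positivity) (by positivity)).trans
            (ENNReal.ofReal_le_ofReal ?_)
          have hkK : (k : ℝ) ≤ K := by
            exact_mod_cast Nat.lt_succ_iff.1 (Finset.mem_range.1 hk)
          have : (k : ℝ) * e * (n : ℝ) ^ 2 / (e * (n : ℝ) ^ 2) ^ 2 =
              k * e / e ^ 2 * (1 / (n : ℝ) ^ 2) := by
            field_simp
          rw [this]
          gcongr
      _ = ENNReal.ofReal (c * (1 / (n : ℝ) ^ 2)) := by
          rw [Finset.sum_const, Finset.card_range, nsmul_eq_mul, hc, mul_assoc,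
            ← ENNReal.ofReal_natCast, ← ENNReal.ofReal_mul (by positivity)]
          push_cast
          rfl
  calc P {ω | ¬ HasUniformRate (Γ ω) M ε ((m : ℝ) ^ 2)}
      ≤ P {ω | ¬ ∀ h t, Γ ω (box h t) ≠ ∞} +
          P (⋃ n : ℕ, ⋃ k ∈ Finset.range (K + 1), B (n + m) k) :=
        (measure_mono hsub).trans (measure_union_le _ _)
    _ ≤ 0 + ∑' n : ℕ, ENNReal.ofReal (c * (1 / ((n + m : ℕ) : ℝ) ^ 2)) := by
        refine add_le_add (le_of_eq (ae_iff.1 hΓ.ae_box_ne_top)) ?_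
        exact (measure_iUnion_le _).trans
          (ENNReal.tsum_le_tsum fun n => hBle _ (by omega))
    _ = ENNReal.ofReal (∑' n : ℕ, c * (1 / ((n + m : ℕ) : ℝ) ^ 2)) := by
        rw [zero_add, ENNReal.ofReal_tsum_of_nonneg (fun n => by positivity)
          ((summable_nat_add_iff m).2 hsum)]
    _ ≤ ENNReal.ofReal δ := ENNReal.ofReal_le_ofReal hm1.le

end LogQueue

end

noncomputable section

namespace LogQueue

/-! ### Counting points below a graph -/

lemma pointsBelow_const (γ : Measure (ℝ × ℝ)) (h t : ℝ) :
    pointsBelow γ (fun _ => h) t = γ.real (box h t) := by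
  rw [pointsBelow]
  congr 1
  ext p
  simp only [box, mem_prod, mem_ofPred_eq]
  tauto

lemma pointsBelow_nonneg (γ : Measure (ℝ × ℝ)) (f : ℝ → ℝ) (t : ℝ) : 0 ≤ pointsBelow γ f t :=
  measureReal_nonneg

lemma pointsBelow_le {γ : Measure (ℝ × ℝ)} {f : ℝ → ℝ} {h t : ℝ} (hfin : γ (box h t) ≠ ∞)
    (hf : ∀ u ∈ Ioc 0 t, f u ≤ h) : pointsBelow γ f t ≤ γ.real (box h t) := by
  refine measureReal_mono (fun p hp => ?_) hfin
  exact ⟨⟨hp.2.1, hp.2.2.trans (hf _ hp.1)⟩, hp.1⟩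

/-- Points of height at most `h` with time in `(s, t]` lie below the graph. The bound `H` serves
only to make the count under the graph finite. -/
lemma le_pointsBelow {γ : Measure (ℝ × ℝ)} {f : ℝ → ℝ} {h H s t : ℝ}
    (hfin : ∀ h t, γ (box h t) ≠ ∞) (hf : ∀ u ∈ Ioc s t, h ≤ f u) (hH : ∀ u ∈ Ioc 0 t, f u ≤ H) :
    γ.real (box h t) - γ.real (box h s) ≤ pointsBelow γ f t := by
  have hsub : {p : ℝ × ℝ | p.2 ∈ Ioc 0 t ∧ p.1 ∈ Icc 0 (f p.2)} ⊆ box H t :=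
    fun p hp => ⟨⟨hp.2.1, hp.2.2.trans (hH _ hp.1)⟩, hp.1⟩
  have hle : γ.real (box h t) ≤
      γ.real (box h s ∪ {p : ℝ × ℝ | p.2 ∈ Ioc 0 t ∧ p.1 ∈ Icc 0 (f p.2)}) := by
    refine measureReal_mono (fun p hp => ?_)
      (measure_union_ne_top (hfin h s) (measure_ne_top_of_subset hsub (hfin H t)))
    rcases le_or_gt p.2 s with h1 | h1
    · exact Or.inl ⟨hp.1, hp.2.1, h1⟩
    · exact Or.inr ⟨hp.2, hp.1.1, hp.1.2.trans (hf _ ⟨h1, hp.2.2⟩)⟩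
  have := measureReal_union_le (μ := γ) (box h s)
    {p : ℝ × ℝ | p.2 ∈ Ioc 0 t ∧ p.1 ∈ Icc 0 (f p.2)}
  rw [pointsBelow]
  linarith

/-! ### Bounds on the capacity -/

lemma log_one_add_natCast_nonneg (n : ℕ) : 0 ≤ Real.log (1 + n) :=
  Real.log_nonneg (by have := n.cast_nonneg (α := ℝ); linarith)

lemma capacity_le_one (i : Fin 2) (x : Fin 2 → ℕ) : capacity i x ≤ 1 := by
  have h0 := log_one_add_natCast_nonneg (x 0)
  have h1 := log_one_add_natCast_nonneg (x 1)
  refine div_le_one_of_le₀ ?_ (by positivity)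
  fin_cases i <;> simp [h0, h1]

/-- The fraction increases with the first logarithm and decreases with the second. At the extreme
values it equals `(t l + k) / (t l + l)`, at most `(t + ε) / (t + 1)`. -/
lemma capacity_zero_le {x : Fin 2 → ℕ} {t l k ε : ℝ} (ht : 0 ≤ t) (hl : 0 ≤ l) (hε : 0 ≤ ε)
    (hk : k ≤ ε * l) (h0 : Real.log (1 + x 0) ≤ t * l + k) (h1 : l - k ≤ Real.log (1 + x 1)) :
    capacity 0 x ≤ t / (t + 1) + ε := by
  have hx := log_one_add_natCast_nonneg (x 0)
  have hy := log_one_add_natCast_nonneg (x 1)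
  have hq : 0 ≤ t / (t + 1) + ε := by positivity
  refine div_le_of_le_mul₀ (by positivity) hq ?_
  set q := t / (t + 1) with hqdef
  have hqt : q * (t + 1) = t := by rw [hqdef]; field_simp
  have hq0 : 0 ≤ q := by positivity
  rcases le_total 1 (q + ε) with h | h
  · nlinarith
  · have e1 : (q + ε) * (l - k) ≤ (q + ε) * Real.log (1 + x 1) := by gcongr
    have e2 : (1 - (q + ε)) * Real.log (1 + x 0) ≤ (1 - (q + ε)) * (t * l + k) :=
      mul_le_mul_of_nonneg_left h0 (by linarith)
    have e3 : q * (t + 1) * l = t * l := by rw [hqt]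
    have e4 : 0 ≤ ε * t * l := by positivity
    linarith

lemma le_capacity_zero {x : Fin 2 → ℕ} {t l k ε : ℝ} (ht : 0 ≤ t) (hl : 0 ≤ l) (hε : 0 ≤ ε)
    (hk : k ≤ ε * l) (hpos : 0 < Real.log (1 + x 1))
    (h0 : t * l - k ≤ Real.log (1 + x 0)) (h1 : Real.log (1 + x 1) ≤ l + k) :
    t / (t + 1) - ε ≤ capacity 0 x := by
  have hx := log_one_add_natCast_nonneg (x 0)
  rw [capacity, le_div_iff₀ (by positivity)]
  set q := t / (t + 1) with hqdef
  have hqt : q * (t + 1) = t := by rw [hqdef]; field_simp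
  have hq1 : q ≤ 1 := by rw [hqdef, div_le_one (by positivity)]; linarith
  rcases le_total (q - ε) 0 with h | h
  · nlinarith
  · have e1 : (q - ε) * Real.log (1 + x 1) ≤ (q - ε) * (l + k) := by gcongr
    have e2 : (1 - (q - ε)) * (t * l - k) ≤ (1 - (q - ε)) * Real.log (1 + x 0) :=
      mul_le_mul_of_nonneg_left h0 (by linarith)
    have e3 : q * (t + 1) * l = t * l := by rw [hqt]
    have e4 : 0 ≤ ε * t * l := by positivity
    linarith

/-! ### Sample paths -/

/-- A sample path of the queueing system, driven by the point configurations `α` and `d`. -/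
structure IsPath (lam mu : Fin 2 → ℝ) (α d : Fin 2 → Measure (ℝ × ℝ)) (x : Fin 2 → ℕ)
    (l : Fin 2 → ℝ → ℕ) : Prop where
  initial : ∀ i, l i 0 = x i
  left_limits : ∀ i t, 0 < t → ∃ k : ℕ, Tendsto (l i) (𝓝[<] t) (𝓝 k)
  equation : ∀ i t, 0 ≤ t →
    (l i t : ℝ) = (l i 0 : ℝ) + pointsBelow (α i) (fun _ => lam i) t
      - pointsBelow (d i) (fun u => mu i * capacity i (fun j => Function.leftLim (l j) u)) t

namespace IsPath

variable {lam mu : Fin 2 → ℝ} {α d : Fin 2 → Measure (ℝ × ℝ)} {x : Fin 2 → ℕ}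
  {l : Fin 2 → ℝ → ℕ}

/-- The left limit of a path at `u` is its value at a time shortly before `u`. -/
lemma exists_leftLim_eq (hl : IsPath lam mu α d x l) {v u : ℝ} (hv : 0 ≤ v) (hvu : v < u) :
    ∃ w ∈ Ioo v u, (fun j => Function.leftLim (l j) u) = fun j => l j w := by
  -- Since `ℕ` is discrete, the left limit is attained just before `u`, at a time common to both
  -- queues.
  have hev : ∀ j, ∀ᶠ w in 𝓝[<] u, Function.leftLim (l j) u = l j w := by
    intro j
    obtain ⟨k, hk⟩ := hl.left_limits j u (hv.trans_lt hvu)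
    rw [leftLim_eq_of_tendsto hk]
    rw [nhds_discrete, tendsto_pure] at hk
    exact hk.mono fun _ h => h.symm
  obtain ⟨w, hw1, hw2⟩ := ((eventually_all.2 hev).and (Ioo_mem_nhdsLT hvu)).exists
  exact ⟨w, hw2, funext hw1⟩

lemma le_add_arrivals (hl : IsPath lam mu α d x l) (i : Fin 2) {t : ℝ} (ht : 0 ≤ t) :
    (l i t : ℝ) ≤ x i + (α i).real (box (lam i) t) := by
  have h := hl.equation i t ht
  rw [hl.initial, pointsBelow_const] at h
  have := pointsBelow_nonneg (d i)
    (fun u => mu i * capacity i (fun j => Function.leftLim (l j) u)) t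
  linarith

lemma sub_departures_le (hl : IsPath lam mu α d x l) (i : Fin 2) (hmu : 0 ≤ mu i) {t : ℝ}
    (ht : 0 ≤ t) (hfin : d i (box (mu i) t) ≠ ∞) :
    (x i : ℝ) - (d i).real (box (mu i) t) ≤ l i t := by
  have h := hl.equation i t ht
  rw [hl.initial] at h
  have h1 := pointsBelow_nonneg (α i) (fun _ => lam i) t
  have h2 : pointsBelow (d i) (fun u => mu i * capacity i (fun j => Function.leftLim (l j) u)) t
      ≤ (d i).real (box (mu i) t) :=
    pointsBelow_le hfin fun u _ => mul_le_of_le_one_right hmu (capacity_le_one _ _)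
  linarith

section Rate

variable {M ε T : ℝ} {N : ℕ}

/-- The number of customers at queue `0` at most grows linearly. -/
lemma zero_le_mul (hl : IsPath lam mu α d ![0, N] l) (hα : HasUniformRate (α 0) M ε T)
    (h0 : 0 ≤ lam 0) (hM : lam 0 ≤ M) {u s : ℝ} (hu : 0 ≤ u) (hus : u ≤ s) (hs : T ≤ s) :
    (l 0 u : ℝ) ≤ (lam 0 + ε) * s := by
  have h1 := hl.le_add_arrivals 0 hu
  have h2 := measureReal_mono (box_subset_box (le_refl (lam 0)) hus) (hα.finite (lam 0) s)
  have h3 := (abs_le.1 (hα.rate (lam 0) h0 hM s hs)).2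
  simp only [Matrix.cons_val_zero, Nat.cast_zero, zero_add] at h1
  linarith

/-- Queue `1` stays close to its initial value. -/
lemma abs_one_sub_le (hl : IsPath lam mu α d ![0, N] l) (hα : HasUniformRate (α 1) M ε T)
    (hd : HasUniformRate (d 1) M ε T) (h0 : 0 ≤ lam 1) (hM : lam 1 ≤ M) (h0' : 0 ≤ mu 1)
    (hM' : mu 1 ≤ M) {u s : ℝ} (hu : 0 ≤ u) (hus : u ≤ s) (hs : T ≤ s) :
    |(l 1 u : ℝ) - N| ≤ (M + ε) * s := by
  have hs0 : 0 ≤ s := hu.trans hus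
  have h1 := hl.le_add_arrivals 1 hu
  have h2 := measureReal_mono (box_subset_box (le_refl (lam 1)) hus) (hα.finite (lam 1) s)
  have h3 := (abs_le.1 (hα.rate (lam 1) h0 hM s hs)).2
  have k1 := hl.sub_departures_le 1 h0' hu (hd.finite _ _)
  have k2 := measureReal_mono (box_subset_box (le_refl (mu 1)) hus) (hd.finite (mu 1) s)
  have k3 := (abs_le.1 (hd.rate (mu 1) h0' hM' s hs)).2
  have e1 : lam 1 * s ≤ M * s := by gcongr
  have e2 : mu 1 * s ≤ M * s := by gcongr
  simp only [Matrix.cons_val_one, Matrix.cons_val_fin_one] at h1 k1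
  rw [abs_le]
  constructor <;> linarith

/-- Before time `N ^ t`, queue `0` receives at most a fraction about `t / (t + 1)`. -/
lemma capacity_zero_le (hl : IsPath lam mu α d ![0, N] l) (hα : ∀ i, HasUniformRate (α i) M ε T)
    (hd : ∀ i, HasUniformRate (d i) M ε T) (hlam : ∀ i, 0 < lam i) (hmu : ∀ i, 0 < mu i)
    (hlamM : ∀ i, lam i ≤ M) (hmuM : ∀ i, mu i ≤ M) (hε : 0 ≤ ε) (hN : 1 ≤ N) {t : ℝ} (ht : 0 ≤ t)
    (hT : T ≤ (N : ℝ) ^ t) (hsmall : (M + ε) * (N : ℝ) ^ t ≤ N / 2)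
    (hlog : Real.log (2 + M + ε) ≤ ε * Real.log N) {u : ℝ} (hu : 0 ≤ u) (hut : u ≤ (N : ℝ) ^ t) :
    capacity 0 (fun j => l j u) ≤ t / (t + 1) + ε := by
  have hN' : (1 : ℝ) ≤ N := by exact_mod_cast hN
  have hM0 : 0 < M := (hlam 0).trans_le (hlamM 0)
  have hst : 1 ≤ (N : ℝ) ^ t := Real.one_le_rpow hN' ht
  have h0 := hl.zero_le_mul (hα 0) (hlam 0).le (hlamM 0) hu hut hT
  have h1 := (abs_le.1 (hl.abs_one_sub_le (hα 1) (hd 1) (hlam 1).le (hlamM 1) (hmu 1).le (hmuM 1)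
    hu hut hT)).1
  refine LogQueue.capacity_zero_le ht (Real.log_nonneg hN') hε hlog ?_ ?_
  · rw [← Real.log_rpow (by linarith), ← Real.log_mul (by positivity) (by positivity)]
    refine Real.log_le_log (by positivity) ?_
    have : (lam 0 + ε) * (N : ℝ) ^ t ≤ (M + ε) * (N : ℝ) ^ t := by
      gcongr; exact hlamM 0
    linarith
  · rw [← Real.log_div (by positivity) (by positivity)]
    refine Real.log_le_log (by positivity) ?_
    have : (N : ℝ) / (2 + M + ε) ≤ N / 2 := by gcongr; linarith
    linarith

/-- Lower bound for queue `0` at time `N ^ t`. -/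
lemma le_zero_rpow (hl : IsPath lam mu α d ![0, N] l) (hα : ∀ i, HasUniformRate (α i) M ε T)
    (hd : ∀ i, HasUniformRate (d i) M ε T) (hlam : ∀ i, 0 < lam i) (hmu : ∀ i, 0 < mu i)
    (hlamM : ∀ i, lam i ≤ M) (hmuM : ∀ i, 2 * mu i ≤ M) (hε : 0 ≤ ε) (hε1 : ε ≤ 1) (hN : 1 ≤ N)
    {t : ℝ} (ht : 0 ≤ t) (hT : T ≤ (N : ℝ) ^ t) (hsmall : (M + ε) * (N : ℝ) ^ t ≤ N / 2)
    (hlog : Real.log (2 + M + ε) ≤ ε * Real.log N) :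
    (lam 0 - mu 0 * (t / (t + 1)) - (mu 0 + 2) * ε) * (N : ℝ) ^ t ≤ l 0 ((N : ℝ) ^ t) := by
  set s := (N : ℝ) ^ t with hs
  have hs0 : 0 ≤ s := by positivity
  have hmu0 := hmu 0
  have hq0 : 0 ≤ t / (t + 1) := by positivity
  have hq1 : t / (t + 1) ≤ 1 := by rw [div_le_one (by positivity)]; linarith
  have hdep : pointsBelow (d 0)
      (fun u => mu 0 * capacity 0 (fun j => Function.leftLim (l j) u)) s
      ≤ (d 0).real (box (mu 0 * (t / (t + 1) + ε)) s) := by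
    refine pointsBelow_le ((hd 0).finite _ _) fun u hu => ?_
    obtain ⟨w, hw, hwu⟩ := hl.exists_leftLim_eq le_rfl hu.1
    rw [hwu]
    gcongr
    exact hl.capacity_zero_le hα hd hlam hmu hlamM (fun i => by linarith [hmu i, hmuM i])
      hε hN ht hT hsmall hlog hw.1.le (hw.2.le.trans hu.2)
  -- The height is at most `2 * mu 0`, whence the hypothesis `2 * mu i ≤ M`.
  have hd' := (abs_le.1 ((hd 0).rate (mu 0 * (t / (t + 1) + ε)) (by positivity)
    (by nlinarith [hmuM 0]) s hT)).2
  have hα' := (abs_le.1 ((hα 0).rate (lam 0) (hlam 0).le (hlamM 0) s hT)).1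
  have heq := hl.equation 0 s hs0
  rw [hl.initial, pointsBelow_const] at heq
  simp only [Matrix.cons_val_zero, Nat.cast_zero, zero_add] at heq
  linarith

/-- On the time interval `[ε N ^ t, N ^ t]`, queue `0` receives at least a fraction about
`t / (t + 1)` if it is not too small. -/
lemma le_capacity_zero (hl : IsPath lam mu α d ![0, N] l) (hα : ∀ i, HasUniformRate (α i) M ε T)
    (hd : ∀ i, HasUniformRate (d i) M ε T) (hlam : ∀ i, 0 < lam i) (hmu : ∀ i, 0 < mu i)
    (hlamM : ∀ i, lam i ≤ M) (hmuM : ∀ i, mu i ≤ M) (hε : 0 ≤ ε) (hN : 2 ≤ N) {t : ℝ} (ht : 0 ≤ t)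
    (hT : T ≤ (N : ℝ) ^ t) (hsmall : (M + ε) * (N : ℝ) ^ t ≤ N / 2)
    {k : ℝ} (hk : 0 < k) (hlog : Real.log (3 + k⁻¹) ≤ ε * Real.log N) {u : ℝ}
    (hu : 0 ≤ u) (hut : u ≤ (N : ℝ) ^ t) (hlu : k * (N : ℝ) ^ t ≤ l 0 u) :
    t / (t + 1) - ε ≤ capacity 0 (fun j => l j u) := by
  have hN' : (2 : ℝ) ≤ N := by exact_mod_cast hN
  have h1 := abs_le.1 (hl.abs_one_sub_le (hα 1) (hd 1) (hlam 1).le (hlamM 1) (hmu 1).le (hmuM 1)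
    hu hut hT)
  have hst : 0 < (N : ℝ) ^ t := by positivity
  refine LogQueue.le_capacity_zero ht (Real.log_nonneg (by linarith)) hε hlog
    (Real.log_pos (by linarith)) ?_ ?_
  · rw [← Real.log_rpow (by linarith), ← Real.log_div (by positivity) (by positivity)]
    refine Real.log_le_log (by positivity) ?_
    have : (N : ℝ) ^ t / (3 + k⁻¹) ≤ (N : ℝ) ^ t / k⁻¹ := by gcongr; linarith
    rw [div_inv_eq_mul] at this
    linarith
  · rw [← Real.log_mul (by positivity) (by positivity)]
    refine Real.log_le_log (by positivity) ?_
    have : 0 ≤ (N : ℝ) * k⁻¹ := by positivity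
    linarith

/-- Upper bound for queue `0` at time `N ^ t`. -/
lemma zero_rpow_le (hl : IsPath lam mu α d ![0, N] l) (hα : ∀ i, HasUniformRate (α i) M ε T)
    (hd : ∀ i, HasUniformRate (d i) M ε T) (hlam : ∀ i, 0 < lam i) (hmu : ∀ i, 0 < mu i)
    (hlamM : ∀ i, lam i ≤ M) (hmuM : ∀ i, mu i ≤ M) (hε : 0 ≤ ε) (hε1 : ε ≤ 1) (hN : 2 ≤ N)
    {t : ℝ} (ht : 0 ≤ t) (hT : T ≤ ε * (N : ℝ) ^ t) (hsmall : (M + ε) * (N : ℝ) ^ t ≤ N / 2)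
    {k : ℝ} (hk : 0 < k) (hlog : Real.log (3 + k⁻¹) ≤ ε * Real.log N)
    (hlu : ∀ u, ε * (N : ℝ) ^ t ≤ u → u ≤ (N : ℝ) ^ t → k * (N : ℝ) ^ t ≤ l 0 u) :
    (l 0 ((N : ℝ) ^ t) : ℝ) ≤
      (lam 0 - mu 0 * (t / (t + 1)) + (2 * mu 0 + 3) * ε) * (N : ℝ) ^ t := by
  set s := (N : ℝ) ^ t with hs
  have hs0 : 0 ≤ s := by positivity
  have hεs : ε * s ≤ s := mul_le_of_le_one_left hs0 hε1
  have hmu0 := hmu 0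
  have hq1 : t / (t + 1) ≤ 1 := by rw [div_le_one (by positivity)]; linarith
  have hup := hl.zero_le_mul (hα 0) (hlam 0).le (hlamM 0) hs0 le_rfl (hT.trans hεs)
  have hεs0 : 0 ≤ ε * s := by positivity
  have hmεs : 0 ≤ mu 0 * (ε * s) := by positivity
  -- If the height is nonpositive, the bound from arrivals alone suffices.
  rcases le_total (mu 0 * (t / (t + 1) - ε)) 0 with h | h
  · have := mul_nonpos_of_nonpos_of_nonneg h hs0
    linarith
  have hdep : (d 0).real (box (mu 0 * (t / (t + 1) - ε)) s)
      - (d 0).real (box (mu 0 * (t / (t + 1) - ε)) (ε * s)) ≤ pointsBelow (d 0)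
      (fun u => mu 0 * capacity 0 (fun j => Function.leftLim (l j) u)) s := by
    refine le_pointsBelow (H := mu 0) (hd 0).finite (fun u hu => ?_)
      fun u _ => mul_le_of_le_one_right hmu0.le (capacity_le_one _ _)
    obtain ⟨w, hw, hwu⟩ := hl.exists_leftLim_eq hεs0 hu.1
    rw [hwu]
    gcongr
    have hws : w ≤ s := hw.2.le.trans hu.2
    exact hl.le_capacity_zero hα hd hlam hmu hlamM hmuM hε hN ht (hT.trans hεs) hsmall hk hlog
      (hεs0.trans hw.1.le) hws (hlu w hw.1.le hws)
  have hle : mu 0 * (t / (t + 1) - ε) ≤ mu 0 := mul_le_of_le_one_right hmu0.le (by linarith)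
  have hd1 := (abs_le.1 ((hd 0).rate _ h (hle.trans (hmuM 0)) s (hT.trans hεs))).1
  have hd2 := (abs_le.1 ((hd 0).rate _ h (hle.trans (hmuM 0)) (ε * s) hT)).2
  have hα' := (abs_le.1 ((hα 0).rate (lam 0) (hlam 0).le (hlamM 0) s (hT.trans hεs))).2
  have heq := hl.equation 0 s hs0
  rw [hl.initial, pointsBelow_const] at heq
  simp only [Matrix.cons_val_zero, Nat.cast_zero, zero_add] at heq
  -- Ignoring departures before `ε s` costs at most `mu 0 * ε * s`; the deficit `ε` in the share
  -- costs as much, and the three counts add at most `3 ε s`.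
  have e1 : mu 0 * (t / (t + 1) - ε) * (ε * s) ≤ mu 0 * (ε * s) := by gcongr
  have e2 : ε * (ε * s) ≤ 1 * (ε * s) := by gcongr
  linarith

end Rate

end IsPath

/-! ### Uniform estimate on the logarithmic time scale -/

/-- If the driving noises obey the law of large numbers, then queue `0` is, on the logarithmic time
scale, uniformly close to its limit. -/
theorem exists_forall_eventually_abs_sub_le {lam mu : Fin 2 → ℝ} (hlam : ∀ i, 0 < lam i)
    (hmu : ∀ i, 0 < mu i) {M : ℝ} (hlamM : ∀ i, lam i ≤ M) (hmuM : ∀ i, 2 * mu i ≤ M) {a b δ : ℝ}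
    (ha : 0 < a) (hab : a ≤ b) (hb : b < 1) (hsub : mu 0 * (b / (b + 1)) < lam 0) (hδ : 0 < δ) :
    ∃ ε > 0, ∀ T : ℝ, ∀ᶠ N : ℕ in atTop, ∀ (α d : Fin 2 → Measure (ℝ × ℝ)) (l : Fin 2 → ℝ → ℕ),
      IsPath lam mu α d ![0, N] l → (∀ i, HasUniformRate (α i) M ε T) →
      (∀ i, HasUniformRate (d i) M ε T) → ∀ t ∈ Icc a b,
        |(l 0 ((N : ℝ) ^ t) : ℝ) / (N : ℝ) ^ t - (lam 0 - mu 0 * (t / (t + 1)))| ≤ δ := by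
  have hmu0 := hmu 0
  -- Half the smallest limiting slope on `[a, b]`; the other half absorbs the error `(mu 0 + 2) *
  -- ε`.
  set c := (lam 0 - mu 0 * (b / (b + 1))) / 2 with hc
  have hc0 : 0 < c := by rw [hc]; linarith
  obtain ⟨ε, hε, hε1, hεδ, hεc⟩ : ∃ ε > 0, ε ≤ 1 ∧ (2 * mu 0 + 3) * ε ≤ δ ∧
      (mu 0 + 2) * ε ≤ c := by
    refine ⟨min 1 (min (δ / (2 * mu 0 + 3)) (c / (mu 0 + 2))), by positivity, min_le_left _ _,
      ?_, ?_⟩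
    · rw [mul_comm, ← le_div_iff₀ (by positivity)]
      exact (min_le_right _ _).trans (min_le_left _ _)
    · rw [mul_comm, ← le_div_iff₀ (by positivity)]
      exact (min_le_right _ _).trans (min_le_right _ _)
  refine ⟨ε, hε, fun T => ?_⟩
  have hM0 : 0 < M := (hlam 0).trans_le (hlamM 0)
  have hcast := tendsto_natCast_atTop_atTop (R := ℝ)
  have hpow : ∀ {p : ℝ}, 0 < p → Tendsto (fun N : ℕ => (N : ℝ) ^ p) atTop atTop :=
    fun hp => (tendsto_rpow_atTop hp).comp hcast
  have hlogN : Tendsto (fun N : ℕ => Real.log N) atTop atTop := Real.tendsto_log_atTop.comp hcast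
  filter_upwards [(hpow (half_pos ha)).eventually_ge_atTop T,
    (hpow (half_pos ha)).eventually_ge_atTop ε⁻¹,
    (hpow (sub_pos.2 hb)).eventually_ge_atTop (2 * (M + ε)),
    hlogN.eventually_ge_atTop (Real.log (2 + M + ε) / ε),
    hlogN.eventually_ge_atTop (Real.log (3 + (c * ε)⁻¹) / ε), eventually_ge_atTop 2]
    with N hN1 hN2 hN3 hN4 hN5 hN6 α d l hl hα hd
  rw [div_le_iff₀' hε] at hN4 hN5
  have hN' : (2 : ℝ) ≤ N := by exact_mod_cast hN6
  have hN0 : (0 : ℝ) < N := by linarith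
  have hsmall : ∀ t ≤ b, (M + ε) * (N : ℝ) ^ t ≤ N / 2 := by
    intro t ht
    have h1 : (N : ℝ) ^ t ≤ (N : ℝ) ^ b := Real.rpow_le_rpow_of_exponent_le (by linarith) ht
    have h2 : (N : ℝ) ^ (1 - b) * (N : ℝ) ^ b = N := by
      rw [← Real.rpow_add hN0]; simp
    have h3 : 2 * (M + ε) * (N : ℝ) ^ b ≤ (N : ℝ) ^ (1 - b) * (N : ℝ) ^ b := by gcongr
    have h4 : (M + ε) * (N : ℝ) ^ t ≤ (M + ε) * (N : ℝ) ^ b := by gcongr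
    linarith
  -- The range starts at `a / 2` because the upper bound at `t ≥ a` needs queue `0` from time `ε N ^
  -- t` on, which exceeds `N ^ (a / 2)` for large `N`.
  have hlow : ∀ t, a / 2 ≤ t → t ≤ b →
      (lam 0 - mu 0 * (t / (t + 1)) - (mu 0 + 2) * ε) * (N : ℝ) ^ t ≤ l 0 ((N : ℝ) ^ t) :=
    fun t ht1 ht2 => hl.le_zero_rpow hα hd hlam hmu hlamM hmuM hε.le hε1 (by omega) (by linarith)
      (hN1.trans (Real.rpow_le_rpow_of_exponent_le (by linarith) ht1)) (hsmall t ht2) hN4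
  have hlow' : ∀ u, (N : ℝ) ^ (a / 2) ≤ u → u ≤ (N : ℝ) ^ b → c * u ≤ l 0 u := by
    intro u hu1 hu2
    have hu0 : 0 < u := lt_of_lt_of_le (by positivity) hu1
    have hu : (N : ℝ) ^ Real.logb N u = u := Real.rpow_logb hN0 (by linarith) hu0
    rw [← hu] at hu1 hu2
    rw [Real.rpow_le_rpow_left_iff (by linarith)] at hu1 hu2
    have h := hlow _ hu1 hu2
    rw [hu] at h
    refine le_trans ?_ h
    gcongr
    have : Real.logb N u / (Real.logb N u + 1) ≤ b / (b + 1) := by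
      rw [div_le_div_iff₀ (by linarith) (by linarith)]
      linarith
    have : mu 0 * (Real.logb N u / (Real.logb N u + 1)) ≤ mu 0 * (b / (b + 1)) := by gcongr
    linarith
  intro t ht
  have hst : 0 < (N : ℝ) ^ t := by positivity
  have hεst : (N : ℝ) ^ (a / 2) ≤ ε * (N : ℝ) ^ t := by
    have h1 : (N : ℝ) ^ (a / 2) * (N : ℝ) ^ (a / 2) ≤ (N : ℝ) ^ t := by
      rw [← Real.rpow_add hN0]
      exact Real.rpow_le_rpow_of_exponent_le (by linarith) (by linarith [ht.1])
    have h2 : 1 ≤ ε * (N : ℝ) ^ (a / 2) := by rwa [inv_le_iff_one_le_mul₀' hε] at hN2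
    have h3 : 0 < (N : ℝ) ^ (a / 2) := by positivity
    calc (N : ℝ) ^ (a / 2) = 1 * (N : ℝ) ^ (a / 2) := (one_mul _).symm
      _ ≤ ε * (N : ℝ) ^ (a / 2) * (N : ℝ) ^ (a / 2) := by gcongr
      _ = ε * ((N : ℝ) ^ (a / 2) * (N : ℝ) ^ (a / 2)) := mul_assoc _ _ _
      _ ≤ ε * (N : ℝ) ^ t := by gcongr
  have hupper := hl.zero_rpow_le hα hd hlam hmu hlamM (fun i => by linarith [hmu i, hmuM i])
    hε.le hε1 hN6 (ha.le.trans ht.1) (hN1.trans hεst) (hsmall t ht.2) (k := c * ε) (by positivity)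
    hN5 fun u hu1 hu2 => by
      refine le_trans ?_ (hlow' u (hεst.trans hu1)
        (hu2.trans (Real.rpow_le_rpow_of_exponent_le (by linarith) ht.2)))
      rw [mul_assoc]
      gcongr
  have hlower := hlow t (by linarith [ht.1]) ht.2
  rw [← div_le_iff₀ hst] at hupper
  rw [← le_div_iff₀ hst] at hlower
  have : 0 ≤ (mu 0 + 1) * ε := by positivity
  rw [abs_le]
  constructor <;> linarith

end LogQueue

end

noncomputable section

namespace LogQueue

/-! ### Outer expectations -/

/-- A bounded function which is close to a constant outside a small set has an outer expectation
close to this constant. -/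
lemma abs_outerExpectation_sub_le {Ω : Type*} [MeasurableSpace Ω] {P : Measure Ω}
    [IsProbabilityMeasure P] {f : Ω → ℝ} {c B ε η : ℝ} (hη : 0 ≤ η) (hf : ∀ ω, |f ω| ≤ B)
    (hc : |c| ≤ B) (hε : 0 ≤ ε) {S : Set Ω} (hS : P S ≤ ENNReal.ofReal η)
    (hfS : ∀ ω, ω ∉ S → |f ω - c| ≤ ε) :
    |outerExpectation P f - c| ≤ ε + 2 * B * η := by
  have hB : 0 ≤ B := (abs_nonneg c).trans hc
  -- Neither `S` nor `f` need be measurable; the measurable hull of `S` yields a measurable minorant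
  -- and majorant of `f`.
  set U := toMeasurable P S with hU
  have hUm : MeasurableSet U := measurableSet_toMeasurable P S
  have hUη : P.real U ≤ η := by
    rw [measureReal_def, hU, measure_toMeasurable]
    exact ENNReal.toReal_le_of_le_ofReal hη hS
  have hSU : ∀ ω, ω ∉ U → |f ω - c| ≤ ε := fun ω hω =>
    hfS ω fun h => hω (subset_toMeasurable P S h)
  have hint : ∀ y : ℝ, Integrable (U.indicator fun _ => y) P := fun y =>
    (integrable_const y).indicator hUm
  have hval : ∀ x y : ℝ, ∫ ω, (x + U.indicator (fun _ => y) ω) ∂P = x + P.real U * y := by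
    intro x y
    rw [integral_add (integrable_const x) (hint y), integral_indicator_const y hUm]
    simp
  have hlow : ∀ ω, c - ε + U.indicator (fun _ => -(2 * B)) ω ≤ f ω := by
    intro ω
    by_cases hω : ω ∈ U
    · rw [indicator_of_mem hω]
      have h1 := abs_le.1 (hf ω)
      have h2 := abs_le.1 hc
      linarith [h1.1, h2.2]
    · rw [indicator_of_notMem hω]
      linarith [(abs_le.1 (hSU ω hω)).1]
  have hup : ∀ ω, f ω ≤ c + ε + U.indicator (fun _ => 2 * B) ω := by
    intro ω
    by_cases hω : ω ∈ U
    · rw [indicator_of_mem hω]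
      have h1 := abs_le.1 (hf ω)
      have h2 := abs_le.1 hc
      linarith [h1.2, h2.1]
    · rw [indicator_of_notMem hω]
      linarith [(abs_le.1 (hSU ω hω)).2]
  have hbound : P.real U * (2 * B) ≤ η * (2 * B) := by gcongr
  have hlb : ∀ x ∈ {x : ℝ | ∃ g : Ω → ℝ, Measurable g ∧ Integrable g P ∧ (∀ ω, f ω ≤ g ω) ∧
      x = ∫ ω, g ω ∂P}, c - ε - 2 * B * η ≤ x := by
    rintro x ⟨g, -, hg, hfg, rfl⟩
    have := integral_mono ((integrable_const (c - ε)).add (hint (-(2 * B)))) hg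
      fun ω => (hlow ω).trans (hfg ω)
    simp only [Pi.add_apply] at this
    rw [hval] at this
    linarith
  have hmem : c + ε + P.real U * (2 * B) ∈ {x : ℝ | ∃ g : Ω → ℝ, Measurable g ∧ Integrable g P ∧
      (∀ ω, f ω ≤ g ω) ∧ x = ∫ ω, g ω ∂P} :=
    ⟨fun ω => c + ε + U.indicator (fun _ => 2 * B) ω,
      measurable_const.add (measurable_const.indicator hUm),
      (integrable_const (c + ε)).add (hint (2 * B)), hup, (hval _ _).symm⟩
  have h1 : outerExpectation P f ≤ c + ε + P.real U * (2 * B) := csInf_le ⟨_, hlb⟩ hmem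
  have h2 : c - ε - 2 * B * η ≤ outerExpectation P f := le_csInf ⟨_, hmem⟩ hlb
  rw [abs_le]
  constructor <;> linarith

/-- Convergence in probability to a constant path, uniformly on compact sets, implies convergence
in distribution. -/
theorem convergesInDistribution_of_measure_le {Ω : ℕ → Type*} [∀ N, MeasurableSpace (Ω N)]
    (P : ∀ N, Measure (Ω N)) [∀ N, IsProbabilityMeasure (P N)] {S : Set ℝ}
    (X : ∀ N, Ω N → ℝ → ℝ) (z : ℝ → ℝ)
    (h : ∀ K ⊆ S, IsCompact K → ∀ δ > 0, ∀ η > 0, ∀ᶠ N in atTop,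
      P N {ω | ¬ ∀ t ∈ K, |X N ω t - z t| ≤ δ} ≤ ENNReal.ofReal η) :
    ConvergesInDistribution P (fun N ω => toPath S (X N ω)) (Measure.dirac ())
      (fun _ => toPath S z) := by
  refine ⟨@measurable_const _ _ (borel _) _ _, fun F => ?_⟩
  rw [integral_const, probReal_univ, one_smul, Metric.tendsto_atTop']
  intro e he
  have hcont : ∀ᶠ y in 𝓝 (toPath S z), |F y - F (toPath S z)| < e / 3 :=
    Metric.tendsto_nhds.1 (F.continuous.tendsto (toPath S z)) (e / 3) (by positivity)
  have hbasis := UniformOnFun.hasBasis_nhds_of_basis S ℝ {K : Set S | IsCompact K} (toPath S z)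
    ⟨∅, isCompact_empty⟩
    (fun K hK K' hK' => ⟨K ∪ K', IsCompact.union hK hK', subset_union_left, subset_union_right⟩)
    Metric.uniformity_basis_dist
  obtain ⟨⟨K, r⟩, ⟨hK, hr⟩, hsub⟩ := hbasis.eventually_iff.1 hcont
  -- Makes `2 * ‖F‖ * η ≤ e / 3`; the `+ 1` covers `F = 0`.
  set η := e / (3 * (2 * ‖F‖ + 1)) with hη
  have hη0 : 0 < η := by positivity
  have hBη : 2 * ‖F‖ * η ≤ e / 3 := by
    rw [hη, mul_div_assoc', div_le_div_iff₀ (by positivity) (by positivity)]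
    nlinarith
  obtain ⟨N₀, hN₀⟩ := eventually_atTop.1 (h (Subtype.val '' K) (by rintro _ ⟨t, -, rfl⟩; exact t.2)
    (IsCompact.image hK continuous_subtype_val) (r / 2) (half_pos hr) η hη0)
  refine ⟨N₀, fun N hN => ?_⟩
  have := abs_outerExpectation_sub_le (P := P N) (f := fun ω => F (toPath S (X N ω)))
    (c := F (toPath S z)) hη0.le (fun ω => F.norm_coe_le_norm _) (F.norm_coe_le_norm _)
    (ε := e / 3) (by positivity) (hN₀ N hN.le) fun ω hω => ?_
  · rw [Real.dist_eq]
    linarith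
  · rw [mem_ofPred_eq, not_not] at hω
    refine (hsub ?_).le
    intro t ht
    have := hω t ⟨t, ht, rfl⟩
    change dist (X N ω t) (z t) < r
    rw [Real.dist_eq]
    linarith

/-! ### The critical exponent and the limit theorem -/

/-- This is the role of `α*`: when `ρ < 1`, positivity of the limiting slope at `b` means `b < ρ /
(1 - ρ)`; when `ρ ≥ 1`, it follows from `b / (b + 1) < 1`. -/
lemma mul_div_lt_of_mem_timeInterval {lam mu b : ℝ} (hlam : 0 < lam) (hmu : 0 < mu)
    (hb : b ∈ timeInterval (lam / mu)) : b < 1 ∧ mu * (b / (b + 1)) < lam := by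
  obtain ⟨hb0, hb1⟩ := hb
  rw [lt_min_iff] at hb1
  refine ⟨by exact_mod_cast hb1.2, ?_⟩
  have h := hb1.1
  rw [alphaStar] at h
  rw [mul_div_assoc', div_lt_iff₀ (by positivity)]
  split_ifs at h with hρ
  · rw [EReal.coe_lt_coe_iff, lt_div_iff₀ (by linarith)] at h
    have h2 : lam / mu * mu = lam := by field_simp
    nlinarith
  · rw [not_lt, le_div_iff₀ hmu] at hρ
    nlinarith

lemma IsSolution.ae_isPath {Ω : Type*} [MeasurableSpace Ω] {P : Measure Ω} {lam mu : Fin 2 → ℝ}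
    {A D : Fin 2 → Ω → Measure (ℝ × ℝ)} {x : Fin 2 → ℕ} {L : Fin 2 → ℝ → Ω → ℕ}
    (hL : IsSolution P lam mu A D x L) :
    ∀ᵐ ω ∂P, IsPath lam mu (fun i => A i ω) (fun i => D i ω) x (fun i t => L i t ω) := by
  filter_upwards [ae_all_iff.2 hL.initial, ae_all_iff.2 hL.left_limits, ae_all_iff.2 hL.equation]
    with ω h1 h2 h3
  exact ⟨h1, h2, h3⟩

end LogQueue

end

theorem proposition1 {Ω : ℕ → Type*} [∀ N, MeasurableSpace (Ω N)]
    (P : ∀ N, Measure (Ω N)) [∀ N, IsProbabilityMeasure (P N)]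
    (lam mu : Fin 2 → ℝ) (hlam : ∀ i, 0 < lam i) (hmu : ∀ i, 0 < mu i)
    (A D : ∀ N, Fin 2 → Ω N → Measure (ℝ × ℝ))
    (hAD : ∀ N, LogQueue.IsDrivingNoise (P N) (A N) (D N))
    (L : ∀ N, Fin 2 → ℝ → Ω N → ℕ)
    (hL : ∀ N, LogQueue.IsSolution (P N) lam mu (A N) (D N) ![0, N] (L N)) :
    LogQueue.ConvergesInDistribution P
      (fun N ω => LogQueue.toPath (LogQueue.timeInterval (lam 0 / mu 0))
        (fun t => (L N 0 ((N : ℝ) ^ t) ω : ℝ) / (N : ℝ) ^ t))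
      (Measure.dirac ())
      (fun _ => LogQueue.toPath (LogQueue.timeInterval (lam 0 / mu 0))
        (fun t => lam 0 - mu 0 * (t / (t + 1)))) := by
  refine LogQueue.convergesInDistribution_of_measure_le P
    (fun N ω t => (L N 0 ((N : ℝ) ^ t) ω : ℝ) / (N : ℝ) ^ t) _ fun K hKS hK δ hδ η hη => ?_
  rcases K.eq_empty_or_nonempty with rfl | hne
  · simp
  obtain ⟨a, haK, ha⟩ := hK.exists_isLeast hne
  obtain ⟨b, hbK, hb⟩ := hK.exists_isGreatest hne
  obtain ⟨hb1, hblam⟩ := LogQueue.mul_div_lt_of_mem_timeInterval (hlam 0) (hmu 0) (hKS hbK)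
  set M := lam 0 + lam 1 + 2 * mu 0 + 2 * mu 1 with hM
  have h0 := hlam 0
  have h1 := hlam 1
  have h2 := hmu 0
  have h3 := hmu 1
  obtain ⟨ε, hε, hpath⟩ := LogQueue.exists_forall_eventually_abs_sub_le hlam hmu (M := M)
    (by intro i; fin_cases i <;> simp <;> linarith) (by intro i; fin_cases i <;> simp <;> linarith)
    (hKS haK).1 (hb haK) hb1 hblam hδ
  -- Each of the four noises may fail with probability `η / 4`.
  obtain ⟨T, -, hT⟩ := LogQueue.exists_forall_measure_not_hasUniformRate_le (M := M) (ε := ε)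
    (by positivity) hε (δ := η / 4) (by positivity)
  filter_upwards [hpath T] with N hN
  have hT' : ∀ Γ, LogQueue.IsPoissonPointProcess (P N) LogQueue.quadrantLebesgue Γ →
      P N {ω | ¬ LogQueue.HasUniformRate (Γ ω) M ε T} ≤ ENNReal.ofReal (η / 4) := hT (P N)
  set G : (Ω N → Measure (ℝ × ℝ)) → Set (Ω N) :=
    fun Γ => {ω | ¬ LogQueue.HasUniformRate (Γ ω) M ε T} with hG
  have hle : P N {ω | ¬ ∀ t ∈ K, |(L N 0 ((N : ℝ) ^ t) ω : ℝ) / (N : ℝ) ^ t -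
      (lam 0 - mu 0 * (t / (t + 1)))| ≤ δ} ≤
      P N ((G (A N 0) ∪ G (A N 1)) ∪ (G (D N 0) ∪ G (D N 1))) := by
    refine measure_mono_ae ?_
    filter_upwards [(hL N).ae_isPath] with ω hω hbad
    by_contra hgood
    change ω ∉ (G (A N 0) ∪ G (A N 1)) ∪ (G (D N 0) ∪ G (D N 1)) at hgood
    simp only [hG, mem_union, mem_ofPred_eq, not_or, not_not] at hgood
    refine hbad fun t ht => hN _ _ _ hω ?_ ?_ t ⟨ha ht, hb ht⟩
    · intro i
      fin_cases i
      exacts [hgood.1.1, hgood.1.2]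
    · intro i
      fin_cases i
      exacts [hgood.2.1, hgood.2.2]
  refine hle.trans ?_
  calc P N ((G (A N 0) ∪ G (A N 1)) ∪ (G (D N 0) ∪ G (D N 1)))
      ≤ (P N (G (A N 0)) + P N (G (A N 1))) + (P N (G (D N 0)) + P N (G (D N 1))) :=
        (measure_union_le _ _).trans
          (add_le_add (measure_union_le _ _) (measure_union_le _ _))
    _ ≤ (ENNReal.ofReal (η / 4) + ENNReal.ofReal (η / 4)) +
        (ENNReal.ofReal (η / 4) + ENNReal.ofReal (η / 4)) :=
        add_le_add (add_le_add (hT' _ ((hAD N).arrivals 0)) (hT' _ ((hAD N).arrivals 1)))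
          (add_le_add (hT' _ ((hAD N).departures 0)) (hT' _ ((hAD N).departures 1)))
    _ = ENNReal.ofReal η := by
        rw [← ENNReal.ofReal_add (by positivity) (by positivity),
          ← ENNReal.ofReal_add (by positivity) (by positivity)]
        congr 1
        ring
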